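/- Let $X\subset\mathbb{R}^n$ be open and let $f=(f^1,\dots,f^n)\colon X\to\mathbb{R}^n$ be a $C^1$ vector field. Suppose the system of ODEs $\dot x=f(x)$ is cooperative, i.e. $\frac{\partial f^i}{\partial x^j}(x)\ge 0$ for all $i\ne j$ and $x\in X$, and irreducible, i.e. for each $x\in X$ the matrix $A=\left[\frac{\partial f^i}{\partial x^j}(x)\right]$ is irreducible (there is no nonempty proper subset $S\subset\{1,\dots,n\}$ with $A_{ij}=0$ for all $i\in S$, $j\notin S$). Let $t\mapsto\phi_t x$ denote the nonextendible solution of the system in $X$ with $\phi_0x=x$, defined on the open interval $(\sigma(x),\tau(x))\ni 0$. Suppose there is a $C^1$ function $H\colon X\to\mathbb{R}$ which is constant on the orbits of the system (a first integral) and whose gradient is positive, i.e. $\frac{\partial H}{\partial x^i}(x)>0$ for all $i$ and all $x\in X$. For $x\in X$ let $\omega(x)$ (respectively $\alpha(x)$) be the set of all $y\in X$ for which there is a sequence $t_k\to\infty$ (respectively $t_k\to-\infty$) in $(\sigma(x),\tau(x))$ with $\phi_{t_k}x\to y$. Then: (i) for each $x\in X$, the set $\omega(x)$ is either a singleton or empty;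 (ii) for each $x\in X$, if $\alpha(x)$ is nonempty, then $x$ is an equilibrium, i.e. $\phi_t x=x$ for all $t\in\mathbb{R}$ (equivalently, $f(x)=0$). -/

import Mathlib

open Set Filter Topology

namespace CooperativeODE

/-- `x' = f(x)` on the set `X`: the curve `γ` is a solution on the open interval `J`, which
contains `0`, with initial condition `γ 0 = x`. The values of `γ` outside `J` are irrelevant. -/
structure IsSolution {n : ℕ} (f : EuclideanSpace ℝ (Fin n) → EuclideanSpace ℝ (Fin n))
    (X : Set (EuclideanSpace ℝ (Fin n))) (x : EuclideanSpace ℝ (Fin n))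
    (J : Set ℝ) (γ : ℝ → EuclideanSpace ℝ (Fin n)) : Prop where
  isOpen : IsOpen J
  ordConnected : J.OrdConnected
  zero_mem : (0 : ℝ) ∈ J
  initial : γ 0 = x
  mem : ∀ t ∈ J, γ t ∈ X
  hasDerivAt : ∀ t ∈ J, HasDerivAt γ (f (γ t)) t

/-- `γ` on `J` is the trajectory of `x`, that is, the nonextendible solution with initial
condition `γ 0 = x`: no solution on a strictly larger open interval extends it. -/
def IsTrajectory {n : ℕ} (f : EuclideanSpace ℝ (Fin n) → EuclideanSpace ℝ (Fin n))
    (X : Set (EuclideanSpace ℝ (Fin n))) (x : EuclideanSpace ℝ (Fin n))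
    (J : Set ℝ) (γ : ℝ → EuclideanSpace ℝ (Fin n)) : Prop :=
  IsSolution f X x J γ ∧
    ∀ (J' : Set ℝ) (γ' : ℝ → EuclideanSpace ℝ (Fin n)),
      IsSolution f X x J' γ' → J ⊆ J' → EqOn γ γ' J → J' = J

/-- `x` is an equilibrium: its trajectory is defined on all of `ℝ` and stays at `x`. -/
def IsEquilibrium {n : ℕ} (f : EuclideanSpace ℝ (Fin n) → EuclideanSpace ℝ (Fin n))
    (X : Set (EuclideanSpace ℝ (Fin n))) (x : EuclideanSpace ℝ (Fin n)) : Prop :=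
  IsTrajectory f X x univ (fun _ => x)

/-- The equilibria are the zeros of the vector field in `X`. -/
theorem isEquilibrium_iff {n : ℕ}
    (f : EuclideanSpace ℝ (Fin n) → EuclideanSpace ℝ (Fin n))
    (X : Set (EuclideanSpace ℝ (Fin n))) (x : EuclideanSpace ℝ (Fin n)) :
    IsEquilibrium f X x ↔ x ∈ X ∧ f x = 0 := by
  constructor
  · rintro ⟨h, -⟩
    exact ⟨h.mem 0 (mem_univ 0),
      (h.hasDerivAt 0 (mem_univ 0)).unique (hasDerivAt_const (0 : ℝ) x)⟩
  · rintro ⟨hx, hf⟩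
    refine ⟨⟨isOpen_univ, ordConnected_univ, mem_univ 0, rfl, fun _ _ => hx, fun t _ => ?_⟩,
      fun J' γ' _ hJ _ => univ_subset_iff.mp hJ⟩
    rw [hf]
    exact hasDerivAt_const t x

/-- The `ω`-limit set of `x`: the points `y ∈ X` that are limits of `φ_{t_k} x` for some
sequence of times `t_k → ∞` in the domain of the trajectory of `x`. -/
def omegaLimitSet {n : ℕ} (f : EuclideanSpace ℝ (Fin n) → EuclideanSpace ℝ (Fin n))
    (X : Set (EuclideanSpace ℝ (Fin n))) (x : EuclideanSpace ℝ (Fin n)) :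
    Set (EuclideanSpace ℝ (Fin n)) :=
  {y | y ∈ X ∧ ∃ (J : Set ℝ) (γ : ℝ → EuclideanSpace ℝ (Fin n)), IsTrajectory f X x J γ ∧
    ∃ t : ℕ → ℝ, (∀ k, t k ∈ J) ∧ Tendsto t atTop atTop ∧
      Tendsto (fun k => γ (t k)) atTop (𝓝 y)}

/-- The `α`-limit set of `x`: as the `ω`-limit set, with `t_k → -∞`. -/
def alphaLimitSet {n : ℕ} (f : EuclideanSpace ℝ (Fin n) → EuclideanSpace ℝ (Fin n))
    (X : Set (EuclideanSpace ℝ (Fin n))) (x : EuclideanSpace ℝ (Fin n)) :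
    Set (EuclideanSpace ℝ (Fin n)) :=
  {y | y ∈ X ∧ ∃ (J : Set ℝ) (γ : ℝ → EuclideanSpace ℝ (Fin n)), IsTrajectory f X x J γ ∧
    ∃ t : ℕ → ℝ, (∀ k, t k ∈ J) ∧ Tendsto t atTop atBot ∧
      Tendsto (fun k => γ (t k)) atTop (𝓝 y)}

/-- The Jacobian matrix `[∂f^i/∂x^j (x)]`. -/
noncomputable def jacobian {n : ℕ}
    (f : EuclideanSpace ℝ (Fin n) → EuclideanSpace ℝ (Fin n))
    (x : EuclideanSpace ℝ (Fin n)) : Matrix (Fin n) (Fin n) ℝ :=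
  Matrix.of fun i j => fderiv ℝ (fun y => f y i) x (EuclideanSpace.single j 1)

/-- Irreducibility of a square matrix with entries of any sign: the index set has no proper
nonempty subset `S` with `A i j = 0` for all `i ∈ S`, `j ∉ S`. -/
def MatrixIrreducible {n : ℕ} (A : Matrix (Fin n) (Fin n) ℝ) : Prop :=
  ∀ S : Set (Fin n), S.Nonempty → S ≠ univ → ∃ i ∈ S, ∃ j ∉ S, A i j ≠ 0

/-- `x' = f(x)` is a cooperative system on `X`. -/
def IsCooperative {n : ℕ} (f : EuclideanSpace ℝ (Fin n) → EuclideanSpace ℝ (Fin n))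
    (X : Set (EuclideanSpace ℝ (Fin n))) : Prop :=
  ∀ x ∈ X, ∀ i j : Fin n, i ≠ j → 0 ≤ jacobian f x i j

/-- `x' = f(x)` is a cooperative irreducible system on `X`. -/
def IsCooperativeIrreducible {n : ℕ}
    (f : EuclideanSpace ℝ (Fin n) → EuclideanSpace ℝ (Fin n))
    (X : Set (EuclideanSpace ℝ (Fin n))) : Prop :=
  IsCooperative f X ∧ ∀ x ∈ X, MatrixIrreducible (jacobian f x)

/-- `H` is a first integral on `X`: continuous on `X` and constant on orbits. -/
def IsFirstIntegral {n : ℕ} (f : EuclideanSpace ℝ (Fin n) → EuclideanSpace ℝ (Fin n))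
    (X : Set (EuclideanSpace ℝ (Fin n))) (H : EuclideanSpace ℝ (Fin n) → ℝ) : Prop :=
  ContinuousOn H X ∧
    ∀ x ∈ X, ∀ (J : Set ℝ) (γ : ℝ → EuclideanSpace ℝ (Fin n)), IsTrajectory f X x J γ →
      ∀ t ∈ J, H (γ t) = H x

/-- All coordinates of the gradient of `H` are positive at every point of `X`. -/
def HasPositiveGradient {n : ℕ} (X : Set (EuclideanSpace ℝ (Fin n)))
    (H : EuclideanSpace ℝ (Fin n) → ℝ) : Prop :=
  ∀ x ∈ X, ∀ i : Fin n, 0 < gradient H x i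

end CooperativeODE

namespace CooperativeODE

variable {n : ℕ} {X : Set (EuclideanSpace ℝ (Fin n))}
  {f : EuclideanSpace ℝ (Fin n) → EuclideanSpace ℝ (Fin n)}
  {H : EuclideanSpace ℝ (Fin n) → ℝ} {x y p : EuclideanSpace ℝ (Fin n)}
  {J J' : Set ℝ} {γ γ' : ℝ → EuclideanSpace ℝ (Fin n)}

/-! Write v = f(γ), h = ∇H(γ) and A for the Jacobian along a solution γ. The velocity solves v' =
Av, the gradient solves the adjoint equation h' = -Aᵀh, and ∑ hᵢvᵢ = 0 because H is constant on
orbits.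

Consider the weighted speed W = ∑ hᵢ|vᵢ|. Formally W' = ∑ hᵢAᵢⱼ(sign(vᵢ)vⱼ - |vⱼ|). The diagonal
terms vanish and cooperativity makes the others nonpositive, so W never increases
(`IsSolution.antitone_weighted_speed`). If v ≠ 0, then h > 0 and ∑ hᵢvᵢ = 0 force a positive and a
nonpositive coordinate of v; irreducibility couples the two groups and makes the sum negative, so W
is not constant on an interval without zeros of v. By LaSalle's argument every α- or ω-limit point y
is an equilibrium. For an α-limit point, W(x) ≤ W(y) = 0, hence f(x) = 0.

For ω-limits, let p be an equilibrium and z = γ ∨ p the coordinatewise supremum. Cooperativity gives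
zᵢ' ≤ fᵢ(z), so H(z) does not increase, as ∇H > 0 and ∇H·f = 0. On the level set of p, H(z) - H(p)
bounds a multiple of each |γᵢ - pᵢ| near p: it is a Lyapunov function, and p is stable in its level
set (`IsSolution.stable_of_velocity_eq_zero`). A stable ω-limit point is the only one. -/

/-! ### Coordinate formulas for derivatives -/

theorem gradient_apply_eq_fderiv (H : EuclideanSpace ℝ (Fin n) → ℝ)
    (x : EuclideanSpace ℝ (Fin n)) (i : Fin n) :
    gradient H x i = fderiv ℝ H x (EuclideanSpace.single i 1) := by
  have h := InnerProductSpace.toDual_symm_apply (𝕜 := ℝ)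
    (x := EuclideanSpace.single i (1 : ℝ)) (y := fderiv ℝ H x)
  rw [EuclideanSpace.inner_single_right] at h
  simpa [gradient] using h

theorem eq_sum_smul_single (w : EuclideanSpace ℝ (Fin n)) :
    w = ∑ i, w i • EuclideanSpace.single i (1 : ℝ) := by
  ext j
  simp [Finset.sum_apply, Pi.single_apply]

theorem fderiv_eq_sum_gradient (H : EuclideanSpace ℝ (Fin n) → ℝ)
    (x w : EuclideanSpace ℝ (Fin n)) :
    fderiv ℝ H x w = ∑ i, gradient H x i * w i := by
  conv_lhs => rw [eq_sum_smul_single w]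
  simp [gradient_apply_eq_fderiv, mul_comm]

theorem fderiv_coord_eq_sum_jacobian (f : EuclideanSpace ℝ (Fin n) → EuclideanSpace ℝ (Fin n))
    (x w : EuclideanSpace ℝ (Fin n)) (i : Fin n) :
    fderiv ℝ (fun y => f y i) x w = ∑ j, jacobian f x i j * w j := by
  conv_lhs => rw [eq_sum_smul_single w]
  simp [jacobian, mul_comm]

theorem contDiffOn_coord (hf : ContDiffOn ℝ 1 f X) (i : Fin n) :
    ContDiffOn ℝ 1 (fun y => f y i) X :=
  (contDiffOn_piLp 2).1 hf i

theorem continuousOn_gradient (hX : IsOpen X) (hH : ContDiffOn ℝ 1 H X) (i : Fin n) :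
    ContinuousOn (fun y => gradient H y i) X := by
  simp only [gradient_apply_eq_fderiv]
  exact (hH.continuousOn_fderiv_of_isOpen hX le_rfl).clm_apply continuousOn_const

theorem continuousOn_jacobian (hX : IsOpen X) (hf : ContDiffOn ℝ 1 f X) (i j : Fin n) :
    ContinuousOn (fun y => jacobian f y i j) X := by
  simp only [jacobian, Matrix.of_apply]
  exact ((contDiffOn_coord hf i).continuousOn_fderiv_of_isOpen hX le_rfl).clm_apply
    continuousOn_const

/-! ### Uniqueness, maximal trajectories and local flow -/

theorem IsSolution.continuousOn (h : IsSolution f X x J γ) : ContinuousOn γ J :=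
  fun t ht => (h.hasDerivAt t ht).continuousAt.continuousWithinAt

theorem IsSolution.shift (h : IsSolution f X x J γ) {s : ℝ} (hs : s ∈ J) :
    IsSolution f X (γ s) ((fun t => t + s) ⁻¹' J) (fun t => γ (t + s)) where
  isOpen := h.isOpen.preimage (by fun_prop)
  ordConnected := h.ordConnected.preimage_mono fun a b hab => by simpa using hab
  zero_mem := by simpa using hs
  initial := by simp
  mem t ht := h.mem _ ht
  hasDerivAt t ht := (h.hasDerivAt (t + s) ht).comp_add_const t s

/-- Agreement is an open condition by local Lipschitz uniqueness, disagreement by continuity, and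
the common interval is connected. -/
theorem IsSolution.eqOn (hX : IsOpen X) (hf : ContDiffOn ℝ 1 f X) (h : IsSolution f X x J γ)
    (h' : IsSolution f X x J' γ') : EqOn γ γ' (J ∩ J') := by
  have hc : IsPreconnected (J ∩ J') := (h.ordConnected.inter h'.ordConnected).isPreconnected
  have hJJ : IsOpen (J ∩ J') := h.isOpen.inter h'.isOpen
  have hcl : ∀ t ∈ J ∩ J', γ t ≠ γ' t → ∀ᶠ s in 𝓝 t, γ s ≠ γ' s := fun t ht hne =>
    ((h.hasDerivAt t ht.1).continuousAt.ne_iff_eventually_ne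
      (h'.hasDerivAt t ht.2).continuousAt).1 hne
  have hop : ∀ t ∈ J ∩ J', γ t = γ' t → ∀ᶠ s in 𝓝 t, γ s = γ' s := by
    intro t ht heq
    obtain ⟨K, s, hs, hK⟩ :=
      (hf.contDiffAt (hX.mem_nhds (h.mem t ht.1))).exists_lipschitzOnWith
    refine ODE_solution_unique_of_eventually (v := fun _ => f) (s := fun _ => s) (K := K)
      (Eventually.of_forall fun _ => hK) ?_ ?_ heq
    · filter_upwards [(h.hasDerivAt t ht.1).continuousAt hs, h.isOpen.mem_nhds ht.1] with u hu hu'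
      exact ⟨h.hasDerivAt u hu', hu⟩
    · rw [heq] at hs
      filter_upwards [(h'.hasDerivAt t ht.2).continuousAt hs, h'.isOpen.mem_nhds ht.2] with u hu hu'
      exact ⟨h'.hasDerivAt u hu', hu⟩
  intro t ht
  by_contra hne
  obtain ⟨s, hs, hs1, hs2⟩ := hc (interior {s | γ s = γ' s}) (interior {s | γ s ≠ γ' s})
    isOpen_interior isOpen_interior
    (fun s hs => by
      by_cases e : γ s = γ' s
      · exact Or.inl (mem_interior_iff_mem_nhds.2 (hop s hs e))
      · exact Or.inr (mem_interior_iff_mem_nhds.2 (hcl s hs e)))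
    ⟨0, ⟨h.zero_mem, h'.zero_mem⟩, mem_interior_iff_mem_nhds.2
      (hop 0 ⟨h.zero_mem, h'.zero_mem⟩ (h.initial.trans h'.initial.symm))⟩
    ⟨t, ht, mem_interior_iff_mem_nhds.2 (hcl t ht hne)⟩
  have e1 : γ s = γ' s := (interior_subset hs1 : s ∈ {s | γ s = γ' s})
  exact (interior_subset hs2 : s ∈ {s | γ s ≠ γ' s}) e1

/-- All solutions with a given initial condition, and at least one, are restrictions of one
trajectory. -/
theorem exists_isTrajectory (hX : IsOpen X) (hf : ContDiffOn ℝ 1 f X)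
    (h : IsSolution f X x J γ) :
    ∃ Γ K, IsTrajectory f X x K Γ ∧
      ∀ J' γ', IsSolution f X x J' γ' → J' ⊆ K ∧ EqOn γ' Γ J' := by
  classical
  let K : Set ℝ := ⋃₀ {J' | ∃ γ', IsSolution f X x J' γ'}
  have hK : ∀ t, ∃ γ' : ℝ → EuclideanSpace ℝ (Fin n), t ∈ K →
      ∃ J', t ∈ J' ∧ IsSolution f X x J' γ' := by
    intro t
    by_cases ht : t ∈ K
    · obtain ⟨J', ⟨γ', h'⟩, ht'⟩ := ht
      exact ⟨γ', fun _ => ⟨J', ht', h'⟩⟩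
    · exact ⟨γ, fun h => absurd h ht⟩
  choose g hg using hK
  have hsub : ∀ J' γ', IsSolution f X x J' γ' → J' ⊆ K := fun J' γ' h' =>
    subset_sUnion_of_mem ⟨γ', h'⟩
  have heq : ∀ J' γ', IsSolution f X x J' γ' → EqOn γ' (fun t => g t t) J' := by
    intro J' γ' h' t ht
    obtain ⟨J'', ht'', h''⟩ := hg t (hsub _ _ h' ht)
    exact h'.eqOn hX hf h'' ⟨ht, ht''⟩
  have hsol : IsSolution f X x K (fun t => g t t) := by
    refine ⟨isOpen_sUnion fun J' ⟨γ', h'⟩ => h'.isOpen, ?_, hsub _ _ h h.zero_mem, ?_, ?_, ?_⟩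
    · refine IsPreconnected.ordConnected (isPreconnected_sUnion 0 _ ?_ ?_)
      · rintro J' ⟨γ', h'⟩
        exact h'.zero_mem
      · rintro J' ⟨γ', h'⟩
        exact h'.ordConnected.isPreconnected
    · exact (heq _ _ h h.zero_mem).symm.trans h.initial
    · rintro t ⟨J', ⟨γ', h'⟩, ht⟩
      have := h'.mem t ht
      rwa [heq _ _ h' ht] at this
    · rintro t ⟨J', ⟨γ', h'⟩, ht⟩
      have := h'.hasDerivAt t ht
      rw [heq _ _ h' ht] at this
      exact this.congr_of_eventuallyEq
        (by filter_upwards [h'.isOpen.mem_nhds ht] with s hs using (heq _ _ h' hs).symm)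
  exact ⟨fun t => g t t, K, ⟨hsol, fun J' γ' h' hJ' _ => (hsub _ _ h').antisymm hJ'⟩,
    fun J' γ' h' => ⟨hsub _ _ h', heq _ _ h'⟩⟩

theorem IsTrajectory.unique (hX : IsOpen X) (hf : ContDiffOn ℝ 1 f X)
    (h : IsTrajectory f X x J γ) (h' : IsTrajectory f X x J' γ') : J = J' ∧ EqOn γ γ' J := by
  obtain ⟨Γ, K, hK, hall⟩ := exists_isTrajectory hX hf h.1
  have e := h.2 K Γ hK.1 (hall _ _ h.1).1 (hall _ _ h.1).2
  have e' := h'.2 K Γ hK.1 (hall _ _ h'.1).1 (hall _ _ h'.1).2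
  subst e
  subst e'
  exact ⟨rfl, fun t ht => ((hall _ _ h.1).2 ht).trans ((hall _ _ h'.1).2 ht).symm⟩

/-- The definition of a first integral speaks of nonextendible solutions only; every solution is a
restriction of one. -/
theorem IsFirstIntegral.eq_of_isSolution (hX : IsOpen X) (hf : ContDiffOn ℝ 1 f X)
    (hfirst : IsFirstIntegral f X H) (h : IsSolution f X x J γ) {t : ℝ} (ht : t ∈ J) :
    H (γ t) = H x := by
  obtain ⟨Γ, K, hK, hall⟩ := exists_isTrajectory hX hf h
  rw [(hall _ _ h).2 ht]
  exact hfirst.2 x (h.initial ▸ h.mem 0 h.zero_mem) K Γ hK t ((hall _ _ h).1 ht)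

/-- A continuous local flow near a point of `X`. -/
theorem exists_local_flow (hX : IsOpen X) (hf : ContDiffOn ℝ 1 f X) (hx : x ∈ X) :
    ∃ δ > 0, ∃ α : EuclideanSpace ℝ (Fin n) → ℝ → EuclideanSpace ℝ (Fin n),
      (∀ᶠ y in 𝓝 x, IsSolution f X y (Ioo (-δ) δ) (α y)) ∧
      ∀ s ∈ Ioo (-δ) δ, ContinuousAt (fun y => α y s) x := by
  obtain ⟨ε, hε, a, r, L, K, hr, hpl⟩ :=
    IsPicardLindelof.of_contDiffAt_one (hf.contDiffAt (hX.mem_nhds hx))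
  obtain ⟨α, hα, hc⟩ :=
    (hpl 0).exists_forall_mem_closedBall_eq_hasDerivWithinAt_continuousOn
  have hnb : Metric.closedBall x r ×ˢ Icc (0 - ε) (0 + ε) ∈ 𝓝 (x, (0 : ℝ)) :=
    prod_mem_nhds (Metric.closedBall_mem_nhds x hr) (Icc_mem_nhds (by linarith) (by linarith))
  have hx0 : α (x, 0) = x := (hα x (Metric.mem_closedBall_self r.2)).1
  have hX' : ∀ᶠ p in 𝓝 (x, (0 : ℝ)), α p ∈ X :=
    (hc.continuousAt hnb) (by rw [hx0]; exact hX.mem_nhds hx)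
  rw [nhds_prod_eq] at hX'
  obtain ⟨pa, hpa, pb, hpb, hp⟩ := eventually_prod_iff.1 hX'
  obtain ⟨δ, hδ, hδb⟩ := Metric.eventually_nhds_iff_ball.1 hpb
  have hball : ∀ t ∈ Ioo (-min δ ε) (min δ ε), t ∈ Metric.ball (0 : ℝ) δ ∧
      t ∈ Ioo (0 - ε) (0 + ε) := by
    intro t ht
    rw [Real.ball_eq_Ioo]
    have := min_le_left δ ε
    have := min_le_right δ ε
    have := ht.1
    have := ht.2
    exact ⟨⟨by linarith, by linarith⟩, by linarith, by linarith⟩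
  refine ⟨min δ ε, lt_min hδ hε, fun y t => α (y, t), ?_, ?_⟩
  · filter_upwards [hpa, Metric.closedBall_mem_nhds x hr] with y hy hyr
    refine ⟨isOpen_Ioo, ordConnected_Ioo, by simp [hδ, hε], (hα y hyr).1,
      fun t ht => hp hy (hδb t (hball t ht).1), fun t ht => ?_⟩
    have ht' := (hball t ht).2
    exact ((hα y hyr).2 t (Ioo_subset_Icc_self ht')).hasDerivAt (Icc_mem_nhds ht'.1 ht'.2)
  · intro s hs
    have hs' := (hball s hs).2
    have := hc.continuousAt (x := (x, s)) (prod_mem_nhds (Metric.closedBall_mem_nhds x hr)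
      (Icc_mem_nhds hs'.1 hs'.2))
    exact this.comp (f := fun y => (y, s)) (by fun_prop)

theorem exists_isSolution (hX : IsOpen X) (hf : ContDiffOn ℝ 1 f X) (hx : x ∈ X) :
    ∃ J γ, IsSolution f X x J γ := by
  obtain ⟨δ, -, α, h, -⟩ := exists_local_flow hX hf hx
  exact ⟨_, _, h.self_of_nhds⟩

/-! ### Variational and adjoint equations along a solution -/

theorem sum_gradient_mul_eq_zero (hX : IsOpen X) (hf : ContDiffOn ℝ 1 f X)
    (hH : ContDiffOn ℝ 1 H X) (hfirst : IsFirstIntegral f X H) (hx : x ∈ X) :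
    ∑ i, gradient H x i * f x i = 0 := by
  obtain ⟨J, γ, h⟩ := exists_isSolution hX hf hx
  rw [← fderiv_eq_sum_gradient]
  have h1 : HasDerivAt (fun t => H (γ t)) (fderiv ℝ H x (f x)) 0 := by
    have hd : HasFDerivAt H (fderiv ℝ H x) (γ 0) := by
      rw [h.initial]
      exact ((hH.differentiableOn one_ne_zero).differentiableAt (hX.mem_nhds hx)).hasFDerivAt
    have := hd.comp_hasDerivAt 0 (h.hasDerivAt 0 h.zero_mem)
    rwa [h.initial] at this
  refine h1.unique ((hasDerivAt_const (0 : ℝ) (H x)).congr_of_eventuallyEq ?_)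
  filter_upwards [h.isOpen.mem_nhds h.zero_mem] with t ht
  exact hfirst.eq_of_isSolution hX hf h ht

theorem IsSolution.hasDerivAt_velocity (hX : IsOpen X) (hf : ContDiffOn ℝ 1 f X)
    (h : IsSolution f X x J γ) {t : ℝ} (ht : t ∈ J) (i : Fin n) :
    HasDerivAt (fun s => f (γ s) i) (∑ j, jacobian f (γ t) i j * f (γ t) j) t := by
  rw [← fderiv_coord_eq_sum_jacobian]
  exact ((((contDiffOn_coord hf i).differentiableOn one_ne_zero).differentiableAt
    (hX.mem_nhds (h.mem t ht))).hasFDerivAt).comp_hasDerivAt t (h.hasDerivAt t ht)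

theorem jacobian_eq_fderiv_apply (hf : DifferentiableAt ℝ f x) (i j : Fin n) :
    jacobian f x i j = fderiv ℝ f x (EuclideanSpace.single j 1) i := by
  have h : HasFDerivAt (fun y => f y i) ((EuclideanSpace.proj i).comp (fderiv ℝ f x)) x :=
    (EuclideanSpace.proj i : EuclideanSpace ℝ (Fin n) →L[ℝ] ℝ).hasFDerivAt.comp x hf.hasFDerivAt
  rw [jacobian, Matrix.of_apply, h.fderiv]
  rfl

theorem tendsto_clm_apply {ι V W : Type*} [NormedAddCommGroup V] [NormedSpace ℝ V]
    [NormedAddCommGroup W] [NormedSpace ℝ W] {l : Filter ι} {L : ι → V →L[ℝ] W} {u : ι → V}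
    {L₀ : V →L[ℝ] W} {u₀ : V} (hL : Tendsto L l (𝓝 L₀)) (hu : Tendsto u l (𝓝 u₀)) :
    Tendsto (fun k => L k (u k)) l (𝓝 (L₀ u₀)) :=
  (isBoundedBilinearMap_apply.continuous.tendsto (L₀, u₀)).comp (hL.prodMk_nhds hu)

/-- The gradient of a first integral solves the adjoint variational equation along solutions,
even though it is merely continuous. -/
theorem IsSolution.hasDerivAt_gradient (hX : IsOpen X) (hf : ContDiffOn ℝ 1 f X)
    (hH : ContDiffOn ℝ 1 H X) (hfirst : IsFirstIntegral f X H)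
    (h : IsSolution f X x J γ) {t : ℝ} (ht : t ∈ J) (i : Fin n) :
    HasDerivAt (fun s => gradient H (γ s) i)
      (-∑ j, gradient H (γ t) j * jacobian f (γ t) j i) t := by
  set e : EuclideanSpace ℝ (Fin n) := EuclideanSpace.single i 1 with he
  have hγX := h.mem t ht
  have hγ : ContinuousAt γ t := (h.hasDerivAt t ht).continuousAt
  have hdf : ∀ y ∈ X, DifferentiableAt ℝ f y := fun y hy =>
    (hf.differentiableOn one_ne_zero).differentiableAt (hX.mem_nhds hy)
  have hdH : ∀ y ∈ X, DifferentiableAt ℝ H y := fun y hy =>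
    (hH.differentiableOn one_ne_zero).differentiableAt (hX.mem_nhds hy)
  have hcf : ContinuousAt (fderiv ℝ f) (γ t) :=
    (hf.continuousOn_fderiv_of_isOpen hX le_rfl).continuousAt (hX.mem_nhds hγX)
  have hcH : ContinuousAt (fderiv ℝ H) (γ t) :=
    (hH.continuousOn_fderiv_of_isOpen hX le_rfl).continuousAt (hX.mem_nhds hγX)
  have hval : (-∑ j, gradient H (γ t) j * jacobian f (γ t) j i) =
      (fun s => -fderiv ℝ H (γ s) (fderiv ℝ f (γ s) e)) t := by
    simp only [fderiv_eq_sum_gradient, jacobian_eq_fderiv_apply (hdf _ hγX), he]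
  rw [hval]
  have hγ2 : Tendsto (fun q : ℝ × ℝ => γ q.2) (𝓝[≠] (0 : ℝ) ×ˢ 𝓝 t) (𝓝 (γ t)) :=
    hγ.tendsto.comp tendsto_snd
  have hq1 : Tendsto (fun q : ℝ × ℝ => q.1) (𝓝[≠] (0 : ℝ) ×ˢ 𝓝 t) (𝓝 0) :=
    tendsto_fst.mono_right nhdsWithin_le_nhds
  have hγ1 : Tendsto (fun q : ℝ × ℝ => γ q.2 + q.1 • e) (𝓝[≠] (0 : ℝ) ×ˢ 𝓝 t) (𝓝 (γ t)) := by
    simpa using hγ2.add (hq1.smul_const e)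
  have hne : ∀ᶠ q : ℝ × ℝ in 𝓝[≠] (0 : ℝ) ×ˢ 𝓝 t, q.1 ≠ 0 :=
    tendsto_fst.eventually (eventually_mem_nhdsWithin)
  have hJ : ∀ᶠ q : ℝ × ℝ in 𝓝[≠] (0 : ℝ) ×ˢ 𝓝 t, q.2 ∈ J :=
    tendsto_snd.eventually (h.isOpen.mem_nhds ht)
  have hq1X : ∀ᶠ q : ℝ × ℝ in 𝓝[≠] (0 : ℝ) ×ˢ 𝓝 t, γ q.2 + q.1 • e ∈ X :=
    hγ1 (hX.mem_nhds hγX)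
  -- H has no second derivatives, so its difference quotients in direction `e` are differentiated in
  -- time instead. Since dH(f) = 0 at the displaced point too, `f (γ s + ε • e)` can be subtracted
  -- for free; the derivative then contains only a difference quotient of `f`, which converges by
  -- strict differentiability.
  refine hasDerivAt_of_tendstoUniformlyOnFilter (l := 𝓝[≠] (0 : ℝ))
    (f := fun ε s => ε⁻¹ * (H (γ s + ε • e) - H (γ s)))
    (f' := fun ε s => fderiv ℝ H (γ s + ε • e) (ε⁻¹ • (f (γ s) - f (γ s + ε • e))))
    (g' := fun s => -fderiv ℝ H (γ s) (fderiv ℝ f (γ s) e)) ?_ ?_ ?_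
  · rw [tendstoUniformlyOnFilter_iff_tendsto]
    refine Tendsto.mono_right ?_ (nhds_le_uniformity (-fderiv ℝ H (γ t) (fderiv ℝ f (γ t) e)))
    refine Tendsto.prodMk_nhds ?_ ?_
    · exact (tendsto_clm_apply (hcH.tendsto.comp hγ2)
        (tendsto_clm_apply (hcf.tendsto.comp hγ2) tendsto_const_nhds)).neg
    · have hstrict : HasStrictFDerivAt f (fderiv ℝ f (γ t)) (γ t) :=
        (hf.contDiffAt (hX.mem_nhds hγX)).hasStrictFDerivAt one_ne_zero
      have hpair : Tendsto (fun q : ℝ × ℝ => (γ q.2, γ q.2 + q.1 • e))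
          (𝓝[≠] (0 : ℝ) ×ˢ 𝓝 t) (𝓝 (γ t, γ t)) := hγ2.prodMk_nhds hγ1
      have ho := hstrict.isLittleO.comp_tendsto hpair
      have ho' : (fun q : ℝ × ℝ => f (γ q.2) - f (γ q.2 + q.1 • e)
          - fderiv ℝ f (γ t) (-(q.1 • e))) =o[𝓝[≠] (0 : ℝ) ×ˢ 𝓝 t] fun q => q.1 := by
        refine Asymptotics.IsLittleO.trans_isBigO
          (g := fun q : ℝ × ℝ => -(q.1 • e)) (ho.congr (fun q => ?_) fun q => ?_) ?_
        · simp
        · simp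
        · exact Asymptotics.IsBigO.of_bound 1 (Eventually.of_forall fun q => by
            simp [he, norm_smul])
      have h0 := ho'.tendsto_inv_smul_nhds_zero
      have hd : Tendsto (fun q : ℝ × ℝ => q.1⁻¹ • (f (γ q.2) - f (γ q.2 + q.1 • e)))
          (𝓝[≠] (0 : ℝ) ×ˢ 𝓝 t) (𝓝 (-fderiv ℝ f (γ t) e)) := by
        have h1 := h0.sub_const (fderiv ℝ f (γ t) e)
        rw [zero_sub] at h1
        refine h1.congr' ?_
        filter_upwards [hne] with q hq
        rw [map_neg, map_smul, sub_neg_eq_add, smul_add, inv_smul_smul₀ hq, add_sub_cancel_right]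
      rw [← map_neg]
      exact tendsto_clm_apply (hcH.tendsto.comp hγ1) hd
  · filter_upwards [hne, hJ, hq1X] with q hq hqJ hqX
    have h1 : HasDerivAt (fun s => H (γ s + q.1 • e))
        (fderiv ℝ H (γ q.2 + q.1 • e) (f (γ q.2))) q.2 :=
      (hdH _ hqX).hasFDerivAt.comp_hasDerivAt q.2 ((h.hasDerivAt q.2 hqJ).add_const _)
    have h2 : HasDerivAt (fun s => H (γ s)) 0 q.2 := by
      refine (hasDerivAt_const q.2 (H x)).congr_of_eventuallyEq ?_
      filter_upwards [h.isOpen.mem_nhds hqJ] with s hs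
      exact hfirst.eq_of_isSolution hX hf h hs
    have h3 := (h1.sub h2).const_mul q.1⁻¹
    have h4 : fderiv ℝ H (γ q.2 + q.1 • e) (f (γ q.2 + q.1 • e)) = 0 := by
      rw [fderiv_eq_sum_gradient]
      exact sum_gradient_mul_eq_zero hX hf hH hfirst hqX
    rw [map_smul, map_sub, h4, smul_eq_mul]
    exact h3
  · filter_upwards [h.isOpen.mem_nhds ht] with s hs
    have h1 := (hdH _ (h.mem s hs)).hasFDerivAt.hasLineDerivAt e
    rw [gradient_apply_eq_fderiv]
    have h2 := h1.tendsto_slope_zero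
    simpa using h2

/-! ### Monotonicity of the weighted speed -/

theorem hasDerivAt_sqrt_sq_add {u : ℝ → ℝ} {u' t ε : ℝ} (hu : HasDerivAt u u' t) (hε : ε ≠ 0) :
    HasDerivAt (fun s => √(u s ^ 2 + ε ^ 2)) (u t / √(u t ^ 2 + ε ^ 2) * u') t := by
  have hpos : 0 < u t ^ 2 + ε ^ 2 := by positivity
  refine (((hu.fun_pow 2).add_const (ε ^ 2)).sqrt hpos.ne').congr_deriv ?_
  have := (Real.sqrt_pos.2 hpos).ne'
  field_simp
  push_cast
  ring

/-- With `a i` = g(vᵢ) and `b i` = g'(vᵢ), the left side is the derivative of ∑ hᵢ g(vᵢ) when h' =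
-Aᵀh and v' = Av. It is used for g = |·| and its smoothing. -/
theorem sum_adjoint_add_sum_mul (h a b v : Fin n → ℝ) (A : Matrix (Fin n) (Fin n) ℝ) :
    ∑ i, ((-∑ j, h j * A j i) * a i + h i * (b i * ∑ j, A i j * v j)) =
      ∑ i, ∑ j, h i * A i j * (b i * v j - a j) := by
  have : ∑ i, (-∑ j, h j * A j i) * a i = ∑ i, ∑ j, -(h i * A i j * a j) := by
    rw [Finset.sum_comm]
    refine Finset.sum_congr rfl fun i _ => ?_
    rw [neg_mul, Finset.sum_mul, Finset.sum_neg_distrib]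
  rw [Finset.sum_add_distrib, this, ← Finset.sum_add_distrib]
  refine Finset.sum_congr rfl fun i _ => ?_
  rw [Finset.mul_sum, Finset.mul_sum, ← Finset.sum_add_distrib]
  exact Finset.sum_congr rfl fun j _ => by ring

/-- Off-diagonal terms are nonpositive since |bᵢ| ≤ 1. Smoothing costs only the diagonal, where bᵢvᵢ
- aᵢ = -ε²/√(vᵢ² + ε²) has absolute value at most ε. -/
theorem sum_adjoint_sqrt_le (h v : Fin n → ℝ) (A : Matrix (Fin n) (Fin n) ℝ)
    (hh : ∀ i, 0 ≤ h i) (hA : ∀ i j, i ≠ j → 0 ≤ A i j) {ε : ℝ} (hε : 0 < ε) :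
    ∑ i, ((-∑ j, h j * A j i) * √(v i ^ 2 + ε ^ 2) +
      h i * (v i / √(v i ^ 2 + ε ^ 2) * ∑ j, A i j * v j)) ≤ (∑ i, h i * |A i i|) * ε := by
  rw [sum_adjoint_add_sum_mul h (fun i => √(v i ^ 2 + ε ^ 2))
    (fun i => v i / √(v i ^ 2 + ε ^ 2)) v A, Finset.sum_mul]
  have hpos : ∀ i, 0 < √(v i ^ 2 + ε ^ 2) := fun i => by positivity
  have hsq : ∀ i, √(v i ^ 2 + ε ^ 2) ^ 2 = v i ^ 2 + ε ^ 2 := fun i =>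
    Real.sq_sqrt (by positivity)
  have habs : ∀ i, |v i| ≤ √(v i ^ 2 + ε ^ 2) := fun i =>
    Real.abs_le_sqrt (by nlinarith)
  have hεle : ∀ i, ε ≤ √(v i ^ 2 + ε ^ 2) := fun i =>
    Real.le_sqrt_of_sq_le (by nlinarith [sq_nonneg (v i)])
  refine Finset.sum_le_sum fun i _ => ?_
  have key : ∀ j, h i * A i j * (v i / √(v i ^ 2 + ε ^ 2) * v j - √(v j ^ 2 + ε ^ 2)) ≤
      if j = i then h i * |A i i| * ε else 0 := by
    intro j
    split_ifs with hij
    · subst hij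
      have e : v j / √(v j ^ 2 + ε ^ 2) * v j - √(v j ^ 2 + ε ^ 2) =
          -(ε ^ 2 / √(v j ^ 2 + ε ^ 2)) := by
        have := (hpos j).ne'
        field_simp
        linarith [hsq j]
      rw [e]
      have h1 : ε ^ 2 / √(v j ^ 2 + ε ^ 2) ≤ ε := by
        rw [div_le_iff₀ (hpos j)]
        nlinarith [hεle j]
      have h2 : 0 ≤ ε ^ 2 / √(v j ^ 2 + ε ^ 2) := by positivity
      have h3 : A j j * -(ε ^ 2 / √(v j ^ 2 + ε ^ 2)) ≤ |A j j| * ε := by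
        nlinarith [neg_abs_le (A j j), abs_nonneg (A j j)]
      rw [mul_assoc, mul_assoc]
      exact mul_le_mul_of_nonneg_left h3 (hh j)
    · refine mul_nonpos_of_nonneg_of_nonpos
        (mul_nonneg (hh i) (hA i j fun e => hij e.symm)) ?_
      have h1 : |v i / √(v i ^ 2 + ε ^ 2)| ≤ 1 := by
        rw [abs_div, abs_of_pos (hpos i)]
        exact div_le_one_of_le₀ (habs i) (hpos i).le
      have h2 : |v i / √(v i ^ 2 + ε ^ 2) * v j| ≤ |v j| := by
        rw [abs_mul]
        exact mul_le_of_le_one_left (abs_nonneg _) h1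
      linarith [le_abs_self (v i / √(v i ^ 2 + ε ^ 2) * v j), habs j]
  refine (Finset.sum_le_sum fun j _ => key j).trans ?_
  simp

theorem sum_adjoint_sign_lt_zero (h v : Fin n → ℝ) (A : Matrix (Fin n) (Fin n) ℝ)
    (hh : ∀ i, 0 < h i) (hA : ∀ i j, i ≠ j → 0 ≤ A i j) (hirr : MatrixIrreducible A)
    (hv : v ≠ 0) (hhv : ∑ i, h i * v i = 0) :
    ∑ i, ((-∑ j, h j * A j i) * |v i| +
      h i * ((SignType.sign (v i) : ℝ) * ∑ j, A i j * v j)) < 0 := by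
  rw [sum_adjoint_add_sum_mul h (fun i => |v i|) (fun i => (SignType.sign (v i) : ℝ)) v A]
  have hsgn : ∀ i j, (SignType.sign (v i) : ℝ) * v j - |v j| ≤ 0 := by
    intro i j
    rcases lt_trichotomy (v i) 0 with hi | hi | hi
    · rw [sign_neg hi]
      simpa using neg_le_abs (v j)
    · rw [hi]
      simp
    · rw [sign_pos hi]
      simpa using le_abs_self (v j)
  have hterm : ∀ i j, h i * A i j * ((SignType.sign (v i) : ℝ) * v j - |v j|) ≤ 0 := by
    intro i j
    rcases eq_or_ne i j with rfl | hij
    · rw [sign_mul_self, sub_self, mul_zero]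
    · exact mul_nonpos_of_nonneg_of_nonpos (mul_nonneg (hh i).le (hA i j hij)) (hsgn i j)
  refine (Finset.sum_nonpos fun i _ => Finset.sum_nonpos fun j _ => hterm i j).lt_of_ne fun h0 => ?_
  have hzero : ∀ i j, h i * A i j * ((SignType.sign (v i) : ℝ) * v j - |v j|) = 0 := fun i j =>
    (Finset.sum_eq_zero_iff_of_nonpos fun j _ => hterm i j).1
      ((Finset.sum_eq_zero_iff_of_nonpos fun i _ =>
        Finset.sum_nonpos fun j _ => hterm i j).1 h0 i (Finset.mem_univ i)) j (Finset.mem_univ j)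
  obtain ⟨p, hp⟩ : ∃ p, 0 < v p := by
    by_contra! hle
    refine hv (funext fun i => ?_)
    have := (Finset.sum_eq_zero_iff_of_nonpos fun i _ =>
      mul_nonpos_of_nonneg_of_nonpos (hh i).le (hle i)).1 hhv i (Finset.mem_univ i)
    exact (mul_eq_zero.1 this).resolve_left (hh i).ne'
  obtain ⟨q, hq⟩ : ∃ q, v q ≤ 0 := by
    by_contra! hlt
    have := Finset.sum_pos (fun i _ => mul_pos (hh i) (hlt i)) ⟨p, Finset.mem_univ p⟩
    exact this.ne' hhv
  -- Irreducibility yields an entry `A i j` ≠ 0 with `v i` ≤ 0 < `v j`; its term has the factor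
  -- sign(vᵢ)vⱼ - |vⱼ| ≤ -vⱼ < 0.
  obtain ⟨i, hi, j, hj, hij⟩ := hirr {i | v i ≤ 0} ⟨q, hq⟩ fun hu =>
    not_le.2 hp (hu ▸ mem_univ p : p ∈ {i | v i ≤ 0})
  have hj' : 0 < v j := not_le.1 hj
  have hs : (SignType.sign (v i) : ℝ) ≤ 0 := by
    rcases (show v i ≤ 0 from hi).lt_or_eq with h' | h'
    · simp [sign_neg h']
    · simp [h']
  have := (mul_eq_zero.1 (hzero i j)).resolve_left (mul_ne_zero (hh i).ne' hij)
  rw [abs_of_pos hj'] at this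
  nlinarith

/-- The absolute value is smoothed on scale ε, the derivative is at most Cε on the compact time
interval, and ε → 0. -/
theorem IsSolution.antitone_weighted_speed (hX : IsOpen X) (hf : ContDiffOn ℝ 1 f X)
    (hcoop : IsCooperative f X) (hH : ContDiffOn ℝ 1 H X) (hfirst : IsFirstIntegral f X H)
    (hgrad : HasPositiveGradient X H) (h : IsSolution f X x J γ) :
    AntitoneOn (fun t => ∑ i, gradient H (γ t) i * |f (γ t) i|) J := by
  intro a ha b hb hab
  have hsub : Icc a b ⊆ J := h.ordConnected.out ha hb
  have hγ : ContinuousOn γ (Icc a b) := h.continuousOn.mono hsub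
  have hmaps : MapsTo γ (Icc a b) X := fun t ht => h.mem t (hsub ht)
  have hC : ContinuousOn (fun t => ∑ i, gradient H (γ t) i * |jacobian f (γ t) i i|) (Icc a b) :=
    continuousOn_finsetSum _ fun i _ => ((continuousOn_gradient hX hH i).comp hγ hmaps).mul
      (((continuousOn_jacobian hX hf i i).comp hγ hmaps).abs)
  obtain ⟨C, hC⟩ := isCompact_Icc.bddAbove_image hC
  have hbound : ∀ ε > 0, ∑ i, gradient H (γ b) i * √(f (γ b) i ^ 2 + ε ^ 2) ≤
      ∑ i, gradient H (γ a) i * √(f (γ a) i ^ 2 + ε ^ 2) + C * ε * (b - a) := by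
    intro ε hε
    have hder : ∀ t ∈ Icc a b, HasDerivAt
        (fun s => ∑ i, gradient H (γ s) i * √(f (γ s) i ^ 2 + ε ^ 2))
        (∑ i, ((-∑ j, gradient H (γ t) j * jacobian f (γ t) j i) * √(f (γ t) i ^ 2 + ε ^ 2) +
          gradient H (γ t) i * (f (γ t) i / √(f (γ t) i ^ 2 + ε ^ 2) *
            ∑ j, jacobian f (γ t) i j * f (γ t) j))) t := by
      intro t ht
      refine HasDerivAt.fun_sum fun i _ => ?_
      refine (h.hasDerivAt_gradient hX hf hH hfirst (hsub ht) i).mul ?_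
      exact hasDerivAt_sqrt_sq_add (h.hasDerivAt_velocity hX hf (hsub ht) i) hε.ne'
    have := (convex_Icc a b).image_sub_le_mul_sub_of_deriv_le
      (fun t ht => (hder t ht).continuousAt.continuousWithinAt)
      (fun t ht => (hder t (interior_subset ht)).differentiableAt.differentiableWithinAt)
      (C := C * ε) (fun t ht => by
        have ht' := interior_subset ht
        rw [(hder t ht').deriv]
        refine (sum_adjoint_sqrt_le _ _ _ (fun i => (hgrad _ (hmaps ht') i).le)
          (hcoop _ (hmaps ht')) hε).trans ?_
        exact mul_le_mul_of_nonneg_right (hC (mem_image_of_mem _ ht')) hε.le)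
      a (left_mem_Icc.2 hab) b (right_mem_Icc.2 hab) hab
    linarith
  have hlim : ∀ t, Tendsto (fun ε : ℝ => ∑ i, gradient H (γ t) i * √(f (γ t) i ^ 2 + ε ^ 2))
      (𝓝[>] 0) (𝓝 (∑ i, gradient H (γ t) i * |f (γ t) i|)) := by
    intro t
    have hc : Continuous fun ε : ℝ => ∑ i, gradient H (γ t) i * √(f (γ t) i ^ 2 + ε ^ 2) := by
      fun_prop
    have := hc.tendsto 0
    simp only [ne_eq, OfNat.ofNat_ne_zero, not_false_eq_true, zero_pow, add_zero,
      Real.sqrt_sq_eq_abs] at this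
    exact this.mono_left nhdsWithin_le_nhds
  have hlim2 : Tendsto (fun ε : ℝ => C * ε * (b - a)) (𝓝[>] 0) (𝓝 0) := by
    have hc : Continuous fun ε : ℝ => C * ε * (b - a) := by fun_prop
    simpa using (hc.tendsto 0).mono_left nhdsWithin_le_nhds
  have := le_of_tendsto_of_tendsto (hlim b) ((hlim a).add hlim2)
    (by filter_upwards [self_mem_nhdsWithin] with ε hε using hbound ε hε)
  simpa using this

/-- Finitely many continuous functions have constant vanishing behaviour on some subinterval. -/
theorem exists_Ioo_forall_eq_zero_or_ne_zero {ι : Type*} (s : Finset ι) (v : ι → ℝ → ℝ)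
    {a b : ℝ} (hab : a < b) (hv : ∀ i, ContinuousOn (v i) (Ioo a b)) :
    ∃ a' b', a' < b' ∧ Ioo a' b' ⊆ Ioo a b ∧
      ∀ i ∈ s, (∀ t ∈ Ioo a' b', v i t = 0) ∨ ∀ t ∈ Ioo a' b', v i t ≠ 0 := by
  classical
  induction s using Finset.induction_on with
  | empty => exact ⟨a, b, hab, subset_rfl, by simp⟩
  | insert i s _ ih =>
    obtain ⟨a', b', hab', hsub, hs⟩ := ih
    by_cases hz : ∀ t ∈ Ioo a' b', v i t = 0
    · refine ⟨a', b', hab', hsub, fun j hj => ?_⟩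
      rcases Finset.mem_insert.1 hj with rfl | hj
      · exact Or.inl hz
      · exact hs j hj
    · push Not at hz
      obtain ⟨t, ht, hne⟩ := hz
      have hc : ContinuousAt (v i) t := (hv i).continuousAt (isOpen_Ioo.mem_nhds (hsub ht))
      obtain ⟨l, u, htlu, hlu⟩ := mem_nhds_iff_exists_Ioo_subset.1
        ((hc.eventually_ne hne).and (isOpen_Ioo.mem_nhds ht))
      refine ⟨l, u, htlu.1.trans htlu.2, fun s hs => hsub (hlu hs).2, fun j hj => ?_⟩
      rcases Finset.mem_insert.1 hj with rfl | hj
      · exact Or.inr fun s hs => (hlu hs).1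
      · exact (hs j hj).imp (fun h s hs => h s (hlu hs).2) fun h s hs => h s (hlu hs).2

/-- On a subinterval where each velocity coordinate is identically zero or never zero, the weighted
speed is differentiable; a nonzero velocity would make its derivative negative. -/
theorem IsSolution.exists_velocity_eq_zero (hX : IsOpen X) (hf : ContDiffOn ℝ 1 f X)
    (hcoop : IsCooperativeIrreducible f X) (hH : ContDiffOn ℝ 1 H X)
    (hfirst : IsFirstIntegral f X H) (hgrad : HasPositiveGradient X H)
    (h : IsSolution f X x J γ) {a b c : ℝ} (hab : a < b) (hJ : Ioo a b ⊆ J)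
    (hconst : ∀ t ∈ Ioo a b, ∑ i, gradient H (γ t) i * |f (γ t) i| = c) :
    ∃ t ∈ Ioo a b, f (γ t) = 0 := by
  obtain ⟨a', b', hab', hsub, hs⟩ := exists_Ioo_forall_eq_zero_or_ne_zero Finset.univ
    (fun i t => f (γ t) i) hab fun i t ht =>
      (h.hasDerivAt_velocity hX hf (hJ ht) i).continuousAt.continuousWithinAt
  obtain ⟨t, ht⟩ := nonempty_Ioo.2 hab'
  refine ⟨t, hsub ht, ?_⟩
  by_contra hne
  have htJ := hJ (hsub ht)
  have hder : HasDerivAt (fun s => ∑ i, gradient H (γ s) i * |f (γ s) i|)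
      (∑ i, ((-∑ j, gradient H (γ t) j * jacobian f (γ t) j i) * |f (γ t) i| +
        gradient H (γ t) i * ((SignType.sign (f (γ t) i) : ℝ) *
          ∑ j, jacobian f (γ t) i j * f (γ t) j))) t := by
    refine HasDerivAt.fun_sum fun i _ => ?_
    refine (h.hasDerivAt_gradient hX hf hH hfirst htJ i).mul ?_
    rcases hs i (Finset.mem_univ i) with hz | hz
    · rw [hz t ht]
      simp only [sign_zero, SignType.coe_zero, zero_mul]
      refine (hasDerivAt_const t (0 : ℝ)).congr_of_eventuallyEq ?_
      filter_upwards [isOpen_Ioo.mem_nhds ht] with s hs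
      rw [hz s hs, abs_zero]
    · exact (hasDerivAt_abs (hz t ht)).comp t (h.hasDerivAt_velocity hX hf htJ i)
  have hlt := sum_adjoint_sign_lt_zero (fun i => gradient H (γ t) i) (fun i => f (γ t) i) _
    (hgrad _ (h.mem t htJ)) (hcoop.1 _ (h.mem t htJ)) (hcoop.2 _ (h.mem t htJ))
    (fun e => hne (by ext i; exact congrFun e i))
    (sum_gradient_mul_eq_zero hX hf hH hfirst (h.mem t htJ))
  refine hlt.ne (hder.unique ((hasDerivAt_const t c).congr_of_eventuallyEq ?_))
  filter_upwards [isOpen_Ioo.mem_nhds (hsub ht)] with s hs using hconst s hs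

/-! ### Limit points are equilibria -/

theorem continuousAt_weighted_speed (hX : IsOpen X) (hf : ContDiffOn ℝ 1 f X)
    (hH : ContDiffOn ℝ 1 H X) (hx : x ∈ X) :
    ContinuousAt (fun y => ∑ i, gradient H y i * |f y i|) x :=
  (continuousOn_finsetSum _ fun i _ => (continuousOn_gradient hX hH i).mul
    (contDiffOn_coord hf i).continuousOn.abs).continuousAt (hX.mem_nhds hx)

/-- If the velocity were nonzero at time 0, it would be nonzero at all small positive times, where
constancy forces a zero. -/
theorem IsSolution.velocity_eq_zero (hX : IsOpen X) (hf : ContDiffOn ℝ 1 f X)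
    (hcoop : IsCooperativeIrreducible f X) (hH : ContDiffOn ℝ 1 H X)
    (hfirst : IsFirstIntegral f X H) (hgrad : HasPositiveGradient X H) {δ c : ℝ} (hδ : 0 < δ)
    (h : IsSolution f X x (Ioo (-δ) δ) γ)
    (hconst : ∀ s ∈ Ioo 0 δ, ∑ i, gradient H (γ s) i * |f (γ s) i| = c) : f x = 0 := by
  by_contra hne
  have hc : ContinuousAt (fun s => f (γ s)) 0 :=
    ContinuousAt.comp (hf.continuousOn.continuousAt (hX.mem_nhds (h.mem 0 h.zero_mem)))
      (h.hasDerivAt 0 h.zero_mem).continuousAt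
  have hev : ∀ᶠ s in 𝓝 (0 : ℝ), f (γ s) ≠ 0 := hc.eventually_ne (by rwa [h.initial])
  obtain ⟨ρ, hρ, hball⟩ := Metric.eventually_nhds_iff_ball.1 hev
  have hsub : Ioo 0 (min ρ δ) ⊆ Ioo 0 δ := Ioo_subset_Ioo_right (min_le_right _ _)
  obtain ⟨t, ht, ht0⟩ := h.exists_velocity_eq_zero hX hf hcoop hH hfirst hgrad
    (lt_min hρ hδ) (hsub.trans (Ioo_subset_Ioo_left (by linarith)))
    fun s hs => hconst s (hsub hs)
  refine hball t ?_ ht0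
  rw [Real.ball_eq_Ioo]
  exact ⟨by linarith [ht.1], by linarith [ht.2, min_le_left ρ δ]⟩

/-- Continuous dependence on initial conditions, along a sequence of points of one solution. -/
theorem IsSolution.exists_tendsto_add (hX : IsOpen X) (hf : ContDiffOn ℝ 1 f X)
    (h : IsSolution f X x J γ) (hy : y ∈ X) {u : ℕ → ℝ} (hu : ∀ k, u k ∈ J)
    (hlim : Tendsto (fun k => γ (u k)) atTop (𝓝 y)) :
    ∃ δ > 0, ∃ β, IsSolution f X y (Ioo (-δ) δ) β ∧
      ∀ s ∈ Ioo (-δ) δ, (∀ᶠ k in atTop, s + u k ∈ J) →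
        Tendsto (fun k => γ (s + u k)) atTop (𝓝 (β s)) := by
  obtain ⟨δ, hδ, α, hα, hc⟩ := exists_local_flow hX hf hy
  refine ⟨δ, hδ, α y, hα.self_of_nhds, fun s hs hJ => ?_⟩
  refine ((hc s hs).tendsto.comp hlim).congr' ?_
  filter_upwards [hlim.eventually hα, hJ] with k hk hkJ
  exact hk.eqOn hX hf (h.shift (hu k)) ⟨hs, hkJ⟩

/-- LaSalle's argument: the weighted speeds at times `u k` and `s + u k` interleave, so by
monotonicity they have the same limit. Hence the weighted speed is constant along the solution
through `y` for small s > 0. -/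
theorem IsSolution.velocity_eq_zero_of_tendsto_atTop (hX : IsOpen X) (hf : ContDiffOn ℝ 1 f X)
    (hcoop : IsCooperativeIrreducible f X) (hH : ContDiffOn ℝ 1 H X)
    (hfirst : IsFirstIntegral f X H) (hgrad : HasPositiveGradient X H)
    (h : IsSolution f X x J γ) (hy : y ∈ X) {u : ℕ → ℝ} (hu : ∀ k, u k ∈ J)
    (htop : Tendsto u atTop atTop) (hlim : Tendsto (fun k => γ (u k)) atTop (𝓝 y)) :
    f y = 0 := by
  obtain ⟨δ, hδ, β, hβ, hcont⟩ := h.exists_tendsto_add hX hf hy hu hlim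
  have hanti := h.antitone_weighted_speed hX hf hcoop.1 hH hfirst hgrad
  have hW := (continuousAt_weighted_speed hX hf hH hy).tendsto.comp hlim
  refine hβ.velocity_eq_zero hX hf hcoop hH hfirst hgrad hδ
    (c := ∑ i, gradient H y i * |f y i|) fun s hs => ?_
  have hs' : s ∈ Ioo (-δ) δ := ⟨by linarith [hs.1], hs.2⟩
  have hJ : ∀ k, s + u k ∈ J := fun k => by
    obtain ⟨m, hm⟩ := (htop.eventually_ge_atTop (s + u k)).exists
    exact h.ordConnected.out (hu k) (hu m) ⟨by linarith [hs.1], hm⟩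
  have hWs := (continuousAt_weighted_speed hX hf hH (hβ.mem s hs')).tendsto.comp
    (hcont s hs' (Eventually.of_forall hJ))
  refine le_antisymm (le_of_tendsto_of_tendsto' hWs hW fun k =>
    hanti (hu k) (hJ k) (by linarith [hs.1])) (ge_of_tendsto' hWs fun k => ?_)
  refine le_of_tendsto hW ?_
  filter_upwards [htop.eventually_ge_atTop (s + u k)] with m hm
  exact hanti (hJ k) (hu m) hm

theorem IsSolution.velocity_eq_zero_of_tendsto_atBot (hX : IsOpen X) (hf : ContDiffOn ℝ 1 f X)
    (hcoop : IsCooperativeIrreducible f X) (hH : ContDiffOn ℝ 1 H X)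
    (hfirst : IsFirstIntegral f X H) (hgrad : HasPositiveGradient X H)
    (h : IsSolution f X x J γ) (hy : y ∈ X) {u : ℕ → ℝ} (hu : ∀ k, u k ∈ J)
    (hbot : Tendsto u atTop atBot) (hlim : Tendsto (fun k => γ (u k)) atTop (𝓝 y)) :
    f y = 0 := by
  obtain ⟨δ, hδ, β, hβ, hcont⟩ := h.exists_tendsto_add hX hf hy hu hlim
  have hanti := h.antitone_weighted_speed hX hf hcoop.1 hH hfirst hgrad
  have hW := (continuousAt_weighted_speed hX hf hH hy).tendsto.comp hlim
  refine hβ.velocity_eq_zero hX hf hcoop hH hfirst hgrad hδ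
    (c := ∑ i, gradient H y i * |f y i|) fun s hs => ?_
  have hs' : s ∈ Ioo (-δ) δ := ⟨by linarith [hs.1], hs.2⟩
  -- Backwards in time, `s + u m` need not lie in `J` for every m, but it does once it is below some
  -- `u k`.
  have hJ : ∀ k, ∀ᶠ m in atTop, s + u m ∈ J ∧ s + u m ≤ u k := fun k => by
    filter_upwards [hbot.eventually_le_atBot (u k - s)] with m hm
    exact ⟨h.ordConnected.out (hu m) (hu k) ⟨by linarith [hs.1], by linarith⟩, by linarith⟩
  have hJ0 := (hJ 0).mono fun m hm => hm.1
  have hWs := (continuousAt_weighted_speed hX hf hH (hβ.mem s hs')).tendsto.comp (hcont s hs' hJ0)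
  refine le_antisymm (le_of_tendsto_of_tendsto hWs hW ?_) (le_of_tendsto' hW fun k => ?_)
  · filter_upwards [hJ0] with k hk
    exact hanti (hu k) hk (by linarith [hs.1])
  · refine ge_of_tendsto hWs ?_
    filter_upwards [hJ k] with m hm
    exact hanti hm.1 (hu k) hm.2

theorem isEquilibrium_of_mem_alphaLimitSet (hX : IsOpen X) (hf : ContDiffOn ℝ 1 f X)
    (hcoop : IsCooperativeIrreducible f X) (hH : ContDiffOn ℝ 1 H X)
    (hfirst : IsFirstIntegral f X H) (hgrad : HasPositiveGradient X H)
    (hx : x ∈ X) (hy : y ∈ alphaLimitSet f X x) : IsEquilibrium f X x := by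
  obtain ⟨hyX, J, γ, h, u, hu, hbot, hlim⟩ := hy
  have hfy := h.1.velocity_eq_zero_of_tendsto_atBot hX hf hcoop hH hfirst hgrad hyX hu hbot hlim
  have hanti := h.1.antitone_weighted_speed hX hf hcoop.1 hH hfirst hgrad
  have hW := (continuousAt_weighted_speed hX hf hH hyX).tendsto.comp hlim
  have hle : ∑ i, gradient H x i * |f x i| ≤ ∑ i, gradient H y i * |f y i| := by
    refine ge_of_tendsto hW ?_
    filter_upwards [hbot.eventually_le_atBot 0] with k hk
    have := hanti (hu k) h.1.zero_mem hk
    simpa only [h.1.initial, Function.comp_apply] using this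
  simp only [hfy, PiLp.zero_apply, abs_zero, mul_zero, Finset.sum_const_zero] at hle
  have hnn : ∀ i ∈ Finset.univ, 0 ≤ gradient H x i * |f x i| := fun i _ =>
    mul_nonneg (hgrad x hx i).le (abs_nonneg _)
  refine (isEquilibrium_iff f X x).2 ⟨hx, ?_⟩
  ext i
  have := (Finset.sum_eq_zero_iff_of_nonneg hnn).1 (hle.antisymm (Finset.sum_nonneg hnn)) i
    (Finset.mem_univ i)
  simpa using (mul_eq_zero.1 this).resolve_left (hgrad x hx i).ne'

/-! ### Estimates on boxes and order intervals -/

theorem norm_le_sum_abs (w : EuclideanSpace ℝ (Fin n)) : ‖w‖ ≤ ∑ i, |w i| := by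
  conv_lhs => rw [eq_sum_smul_single w]
  refine (norm_sum_le _ _).trans (Finset.sum_le_sum fun i _ => ?_)
  simp [norm_smul]

theorem abs_apply_sub_le_dist (x y : EuclideanSpace ℝ (Fin n)) (i : Fin n) :
    |x i - y i| ≤ dist x y := by
  rw [dist_eq_norm]
  simpa using PiLp.norm_apply_le (x - y) i

theorem exists_forall_abs_sub_le_of_eventually {P : EuclideanSpace ℝ (Fin n) → Prop}
    (h : ∀ᶠ w in 𝓝 p, P w) : ∃ r > 0, ∀ w, (∀ i, |w i - p i| ≤ r) → P w := by
  obtain ⟨ρ, hρ, hball⟩ := Metric.eventually_nhds_iff_ball.1 h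
  -- The sum of n coordinates of this size is below ρ; the extra 1 gives strictness and covers n =
  -- 0.
  refine ⟨ρ / (n + 1), by positivity, fun w hw => hball w ?_⟩
  rw [Metric.mem_ball, dist_eq_norm]
  refine (norm_le_sum_abs _).trans_lt ?_
  have h1 : ∑ i, |(w - p) i| ≤ ∑ _i : Fin n, ρ / (n + 1) :=
    Finset.sum_le_sum fun i _ => hw i
  refine h1.trans_lt ?_
  rw [Finset.sum_const, Finset.card_univ, Fintype.card_fin, nsmul_eq_mul, mul_div_assoc',
    div_lt_iff₀ (by positivity)]
  linarith

theorem exists_box_bounds (hX : IsOpen X) (hf : ContDiffOn ℝ 1 f X) (hH : ContDiffOn ℝ 1 H X)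
    (hgrad : HasPositiveGradient X H) (hp : p ∈ X) :
    ∃ r > 0, ∃ c > 0, ∃ M L : ℝ, ∀ w : EuclideanSpace ℝ (Fin n), (∀ i, |w i - p i| ≤ r) →
      w ∈ X ∧ ∀ i, c < gradient H w i ∧ gradient H w i < M ∧ |jacobian f w i i| < L := by
  obtain ⟨c, hc, hc0⟩ : ∃ c, (∀ i, c < gradient H p i) ∧ 0 < c :=
    ((eventually_all.2 fun i => (eventually_lt_nhds (hgrad p hp i)).filter_mono
      nhdsWithin_le_nhds).and (self_mem_nhdsWithin (s := Ioi (0 : ℝ)))).exists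
  obtain ⟨M, hM⟩ : ∃ M, ∀ i, gradient H p i < M :=
    (eventually_all.2 fun i => eventually_gt_atTop (gradient H p i)).exists
  obtain ⟨L, hL⟩ : ∃ L, ∀ i, |jacobian f p i i| < L :=
    (eventually_all.2 fun i => eventually_gt_atTop |jacobian f p i i|).exists
  have hev : ∀ᶠ w in 𝓝 p,
      w ∈ X ∧ ∀ i, c < gradient H w i ∧ gradient H w i < M ∧ |jacobian f w i i| < L := by
    refine Eventually.and (hX.mem_nhds hp) (eventually_all.2 fun i => ?_)
    have h1 := (continuousOn_gradient hX hH i).continuousAt (hX.mem_nhds hp)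
    have h2 := ((continuousOn_jacobian hX hf i i).continuousAt (hX.mem_nhds hp)).abs
    exact (h1.eventually_const_lt (hc i)).and
      ((h1.eventually_lt_const (hM i)).and (h2.eventually_lt_const (hL i)))
  obtain ⟨r, hr, h⟩ := exists_forall_abs_sub_le_of_eventually hev
  exact ⟨r, hr, c, hc0, M, L, h⟩

/-- The mean value inequality on an order interval. -/
theorem le_sub_of_le_fderiv {g : EuclideanSpace ℝ (Fin n) → ℝ} {C : ℝ} (hxy : ∀ i, x i ≤ y i)
    (hd : ∀ w : EuclideanSpace ℝ (Fin n), (∀ i, x i ≤ w i ∧ w i ≤ y i) →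
      DifferentiableAt ℝ g w ∧ C ≤ fderiv ℝ g w (y - x)) : C ≤ g y - g x := by
  have hseg : ∀ t ∈ Icc (0 : ℝ) 1, ∀ i, x i ≤ (x + t • (y - x)) i ∧
      (x + t • (y - x)) i ≤ y i := by
    intro t ht i
    have h1 := mul_nonneg ht.1 (sub_nonneg.2 (hxy i))
    have h2 := mul_nonneg (sub_nonneg.2 ht.2) (sub_nonneg.2 (hxy i))
    simp only [PiLp.add_apply, PiLp.smul_apply, PiLp.sub_apply, smul_eq_mul]
    constructor <;> linarith
  have hder : ∀ t ∈ Icc (0 : ℝ) 1, HasDerivAt (fun t : ℝ => g (x + t • (y - x)))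
      (fderiv ℝ g (x + t • (y - x)) (y - x)) t := by
    intro t ht
    have h1 : HasDerivAt (fun t : ℝ => x + t • (y - x)) (y - x) t := by
      simpa using ((hasDerivAt_id t).smul_const (y - x)).const_add x
    exact (hd _ (hseg t ht)).1.hasFDerivAt.comp_hasDerivAt t h1
  have := (convex_Icc (0 : ℝ) 1).mul_sub_le_image_sub_of_le_deriv
    (fun t ht => (hder t ht).continuousAt.continuousWithinAt)
    (fun t ht => (hder t (interior_subset ht)).differentiableAt.differentiableWithinAt)
    (C := C) (fun t ht => by
      rw [(hder t (interior_subset ht)).deriv]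
      exact (hd _ (hseg t (interior_subset ht))).2)
    0 (by simp) 1 (by simp) zero_le_one
  simpa using this

theorem mul_sub_le_firstIntegral_sub (hX : IsOpen X) (hH : ContDiffOn ℝ 1 H X) {c : ℝ}
    (hc : 0 ≤ c) (hxy : ∀ i, x i ≤ y i)
    (hb : ∀ w : EuclideanSpace ℝ (Fin n), (∀ i, x i ≤ w i ∧ w i ≤ y i) →
      w ∈ X ∧ ∀ i, c ≤ gradient H w i) (i : Fin n) :
    c * (y i - x i) ≤ H y - H x := by
  refine le_sub_of_le_fderiv hxy fun w hw => ?_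
  obtain ⟨hwX, hwc⟩ := hb w hw
  refine ⟨(hH.differentiableOn one_ne_zero).differentiableAt (hX.mem_nhds hwX), ?_⟩
  rw [fderiv_eq_sum_gradient]
  have hnn : ∀ j, 0 ≤ (y - x) j := fun j => sub_nonneg.2 (hxy j)
  exact (mul_le_mul_of_nonneg_right (hwc i) (hnn i)).trans
    (Finset.single_le_sum (f := fun j => gradient H w j * (y - x) j)
      (fun j _ => mul_nonneg (hc.trans (hwc j)) (hnn j)) (Finset.mem_univ i))

/-- Between ordered points the off-diagonal derivatives only increase fᵢ, so a decrease can come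
only from the diagonal entry. -/
theorem IsCooperative.neg_mul_le_sub (hX : IsOpen X) (hf : ContDiffOn ℝ 1 f X)
    (hcoop : IsCooperative f X) {L : ℝ} (hxy : ∀ i, x i ≤ y i)
    (hb : ∀ w : EuclideanSpace ℝ (Fin n), (∀ i, x i ≤ w i ∧ w i ≤ y i) →
      w ∈ X ∧ ∀ i, |jacobian f w i i| ≤ L) (i : Fin n) :
    -L * (y i - x i) ≤ f y i - f x i := by
  refine le_sub_of_le_fderiv (g := fun w => f w i) hxy fun w hw => ?_
  obtain ⟨hwX, hwL⟩ := hb w hw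
  refine ⟨((contDiffOn_coord hf i).differentiableOn one_ne_zero).differentiableAt
    (hX.mem_nhds hwX), ?_⟩
  rw [fderiv_coord_eq_sum_jacobian]
  have hnn : ∀ j, 0 ≤ (y - x) j := fun j => sub_nonneg.2 (hxy j)
  rw [← Finset.add_sum_erase _ _ (Finset.mem_univ i)]
  have h1 : 0 ≤ ∑ j ∈ Finset.univ.erase i, jacobian f w i j * (y - x) j :=
    Finset.sum_nonneg fun j hj => mul_nonneg (hcoop w hwX i j (Finset.ne_of_mem_erase hj).symm)
      (hnn j)
  have h2 : -L * (y - x) i ≤ jacobian f w i i * (y - x) i :=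
    mul_le_mul_of_nonneg_right (by linarith [neg_abs_le (jacobian f w i i), hwL i]) (hnn i)
  simp only [PiLp.sub_apply] at h1 h2 ⊢
  linarith

/-! ### The smoothed supremum with an equilibrium -/

/-- Coordinatewise `p + (x - p)⁺`, smoothed on the scale `ε`; for `ε = 0` it is the supremum of
`x` and `p`. -/
noncomputable def smoothSup (p : EuclideanSpace ℝ (Fin n)) (ε : ℝ)
    (x : EuclideanSpace ℝ (Fin n)) : EuclideanSpace ℝ (Fin n) :=
  WithLp.toLp 2 fun i => p i + ((x i - p i) + √((x i - p i) ^ 2 + ε ^ 2)) / 2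

theorem smoothSup_apply (p : EuclideanSpace ℝ (Fin n)) (ε : ℝ) (x : EuclideanSpace ℝ (Fin n))
    (i : Fin n) :
    smoothSup p ε x i = p i + ((x i - p i) + √((x i - p i) ^ 2 + ε ^ 2)) / 2 := rfl

theorem continuous_smoothSup (p : EuclideanSpace ℝ (Fin n)) :
    Continuous fun q : ℝ × EuclideanSpace ℝ (Fin n) => smoothSup p q.1 q.2 := by
  unfold smoothSup
  fun_prop

theorem smoothSup_self (p : EuclideanSpace ℝ (Fin n)) : smoothSup p 0 p = p := by
  ext i
  simp [smoothSup_apply]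

theorem le_smoothSup_left (p : EuclideanSpace ℝ (Fin n)) (ε : ℝ) (x : EuclideanSpace ℝ (Fin n))
    (i : Fin n) : p i ≤ smoothSup p ε x i := by
  have : |x i - p i| ≤ √((x i - p i) ^ 2 + ε ^ 2) := Real.abs_le_sqrt (by nlinarith)
  rw [smoothSup_apply]
  linarith [neg_abs_le (x i - p i)]

theorem le_smoothSup_right (p : EuclideanSpace ℝ (Fin n)) (ε : ℝ) (x : EuclideanSpace ℝ (Fin n))
    (i : Fin n) : x i ≤ smoothSup p ε x i := by
  have : |x i - p i| ≤ √((x i - p i) ^ 2 + ε ^ 2) := Real.abs_le_sqrt (by nlinarith)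
  rw [smoothSup_apply]
  linarith [le_abs_self (x i - p i)]

theorem smoothSup_sub_le (p : EuclideanSpace ℝ (Fin n)) {ε : ℝ} (hε : 0 ≤ ε)
    (x : EuclideanSpace ℝ (Fin n)) (i : Fin n) : smoothSup p ε x i - p i ≤ |x i - p i| + ε := by
  have : √((x i - p i) ^ 2 + ε ^ 2) ≤ |x i - p i| + ε := by
    refine Real.sqrt_le_iff.2 ⟨by positivity, ?_⟩
    nlinarith [sq_abs (x i - p i), mul_nonneg (abs_nonneg (x i - p i)) hε]
  rw [smoothSup_apply]
  linarith [le_abs_self (x i - p i)]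

theorem abs_sub_le_max_smoothSup_sub (p x : EuclideanSpace ℝ (Fin n)) (i : Fin n) :
    |x i - p i| ≤ max (smoothSup p 0 x i - p i) (smoothSup p 0 x i - x i) := by
  rcases abs_cases (x i - p i) with h | h
  · exact le_max_of_le_left (by linarith [le_smoothSup_right p 0 x i])
  · exact le_max_of_le_right (by linarith [le_smoothSup_left p 0 x i])

theorem hasDerivAt_smoothSup (p : EuclideanSpace ℝ (Fin n)) {ε t : ℝ} (hε : ε ≠ 0)
    {v : EuclideanSpace ℝ (Fin n)} (hγ : HasDerivAt γ v t) :
    HasDerivAt (fun s => smoothSup p ε (γ s))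
      (WithLp.toLp 2 fun i =>
        (1 + (γ t i - p i) / √((γ t i - p i) ^ 2 + ε ^ 2)) / 2 * v i) t := by
  refine ((PiLp.continuousLinearEquiv 2 ℝ fun _ : Fin n => ℝ).symm.hasFDerivAt.comp_hasDerivAt t
    (hasDerivAt_pi.2 fun i => ?_))
  have hi : HasDerivAt (fun s => γ s i - p i) (v i) t :=
    ((EuclideanSpace.proj i : EuclideanSpace ℝ (Fin n) →L[ℝ] ℝ).hasFDerivAt.comp_hasDerivAt t
      hγ).sub_const _
  refine (((hi.add (hasDerivAt_sqrt_sq_add hi hε)).div_const 2).const_add (p i)).congr_deriv ?_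
  ring

/-- The derivative of zᵢ is θfᵢ(x) = θfᵢ(x) + (1 - θ)fᵢ(p) with θ in [0, 1]. As x ≤ z and p ≤ z,
cooperativity bounds it by fᵢ(z) plus an error of order ε, while ∇H·f vanishes at z. -/
theorem fderiv_smoothSup_le (hX : IsOpen X) (hf : ContDiffOn ℝ 1 f X) (hcoop : IsCooperative f X)
    (hH : ContDiffOn ℝ 1 H X) (hfirst : IsFirstIntegral f X H) (hfp : f p = 0)
    {r M L ε : ℝ} (hbox : ∀ w : EuclideanSpace ℝ (Fin n), (∀ i, |w i - p i| ≤ r) →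
      w ∈ X ∧ ∀ i, 0 < gradient H w i ∧ gradient H w i < M ∧ |jacobian f w i i| < L)
    (hε : 0 < ε) (hεr : ε ≤ r / 2) (hx : ∀ i, |x i - p i| ≤ r / 2) :
    fderiv ℝ H (smoothSup p ε x) (WithLp.toLp 2 fun i =>
      (1 + (x i - p i) / √((x i - p i) ^ 2 + ε ^ 2)) / 2 * f x i) ≤ n * (M * L) * ε := by
  set z := smoothSup p ε x with hz
  have hpz := le_smoothSup_left p ε x
  have hxz := le_smoothSup_right p ε x
  have hzr : ∀ i, z i - p i ≤ r := fun i => by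
    linarith [smoothSup_sub_le p hε.le x i, hx i]
  have hbetween : ∀ w : EuclideanSpace ℝ (Fin n), (∀ i, -r ≤ w i - p i ∧ w i ≤ z i) →
      ∀ i, |w i - p i| ≤ r := fun w hw i =>
    abs_le.2 ⟨(hw i).1, by linarith [(hw i).2, hzr i]⟩
  have hzB := hbox z (hbetween z fun i => ⟨by linarith [hpz i], le_rfl⟩)
  rw [fderiv_eq_sum_gradient, ← sub_zero (∑ i, _),
    ← sum_gradient_mul_eq_zero hX hf hH hfirst hzB.1, ← Finset.sum_sub_distrib]
  have hterm : ∀ i, gradient H z i * ((1 + (x i - p i) / √((x i - p i) ^ 2 + ε ^ 2)) / 2 * f x i) -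
      gradient H z i * f z i ≤ M * L * ε := by
    intro i
    have h1 := hcoop.neg_mul_le_sub hX hf (L := L) hxz (fun w hw => by
      have := hbox w (hbetween w fun j => ⟨by linarith [(hw j).1, (abs_le.1 (hx j)).1], (hw j).2⟩)
      exact ⟨this.1, fun j => (this.2 j).2.2.le⟩) i
    have h2 := hcoop.neg_mul_le_sub hX hf (L := L) hpz (fun w hw => by
      have := hbox w (hbetween w fun j => ⟨by linarith [(hw j).1], (hw j).2⟩)
      exact ⟨this.1, fun j => (this.2 j).2.2.le⟩) i
    rw [hfp, PiLp.zero_apply, sub_zero] at h2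
    obtain ⟨hg0, hgM, hL⟩ := hzB.2 i
    have hL0 : 0 ≤ L := (abs_nonneg _).trans hL.le
    have hzi : z i = p i + ((x i - p i) + √((x i - p i) ^ 2 + ε ^ 2)) / 2 := rfl
    have hR : 0 < √((x i - p i) ^ 2 + ε ^ 2) := by positivity
    have hR2 : √((x i - p i) ^ 2 + ε ^ 2) ^ 2 = (x i - p i) ^ 2 + ε ^ 2 :=
      Real.sq_sqrt (by positivity)
    have hRs : |x i - p i| ≤ √((x i - p i) ^ 2 + ε ^ 2) := Real.abs_le_sqrt (by nlinarith)
    have hRε : ε ≤ √((x i - p i) ^ 2 + ε ^ 2) := Real.le_sqrt_of_sq_le (by nlinarith)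
    set s := x i - p i with hs
    set R := √(s ^ 2 + ε ^ 2) with hRdef
    have hθ0 : 0 ≤ (1 + s / R) / 2 := by
      have : -1 ≤ s / R := by
        rw [le_div_iff₀ hR]
        linarith [neg_abs_le s]
      linarith
    have hθ1 : 0 ≤ 1 - (1 + s / R) / 2 := by
      have : s / R ≤ 1 := by
        rw [div_le_iff₀ hR]
        linarith [le_abs_self s]
      linarith
    have e1 := mul_le_mul_of_nonneg_left h1 hθ0
    have e2 := mul_le_mul_of_nonneg_left h2 hθ1
    -- The errors L(zᵢ - xᵢ) and L(zᵢ - pᵢ) are not small separately, but their θ-average is, since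
    -- (R - s)(R + s) = ε².
    have e3 : (1 + s / R) / 2 * (z i - x i) + (1 - (1 + s / R) / 2) * (z i - p i) =
        ε ^ 2 / (2 * R) := by
      have hx' : z i - x i = (R - s) / 2 := by linarith
      have hp' : z i - p i = (R + s) / 2 := by linarith
      rw [hx', hp']
      field_simp
      linarith
    have e4 : ε ^ 2 / (2 * R) ≤ ε := by
      rw [div_le_iff₀ (by positivity)]
      nlinarith
    have e5 : (1 + s / R) / 2 * f x i - f z i ≤ L * ε := by
      have : (1 + s / R) / 2 * f x i - f z i ≤ L * (ε ^ 2 / (2 * R)) := by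
        rw [← e3]
        linarith
      exact this.trans (mul_le_mul_of_nonneg_left e4 hL0)
    rw [← mul_sub]
    calc _ ≤ gradient H z i * (L * ε) := mul_le_mul_of_nonneg_left e5 hg0.le
      _ ≤ M * (L * ε) := mul_le_mul_of_nonneg_right hgM.le (mul_nonneg hL0 hε.le)
      _ = M * L * ε := by ring
  refine (Finset.sum_le_sum fun i _ => hterm i).trans_eq ?_
  simp [mul_assoc]

theorem IsSolution.firstIntegral_smoothSup_le (hX : IsOpen X) (hf : ContDiffOn ℝ 1 f X)
    (hcoop : IsCooperative f X) (hH : ContDiffOn ℝ 1 H X) (hfirst : IsFirstIntegral f X H)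
    (hfp : f p = 0) {r M L : ℝ} (hr : 0 < r)
    (hbox : ∀ w : EuclideanSpace ℝ (Fin n), (∀ i, |w i - p i| ≤ r) →
      w ∈ X ∧ ∀ i, 0 < gradient H w i ∧ gradient H w i < M ∧ |jacobian f w i i| < L)
    (h : IsSolution f X x J γ) {a b : ℝ} (ha : a ∈ J) (hb : b ∈ J) (hab : a ≤ b)
    (hγ : ∀ t ∈ Icc a b, ∀ i, |γ t i - p i| ≤ r / 2) :
    H (smoothSup p 0 (γ b)) ≤ H (smoothSup p 0 (γ a)) := by
  have hsub : Icc a b ⊆ J := h.ordConnected.out ha hb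
  have hzX : ∀ ε, 0 ≤ ε → ε ≤ r / 2 → ∀ t ∈ Icc a b, smoothSup p ε (γ t) ∈ X := by
    intro ε hε hεr t ht
    refine (hbox _ fun i => abs_le.2 ⟨?_, ?_⟩).1
    · linarith [le_smoothSup_left p ε (γ t) i]
    · linarith [smoothSup_sub_le p hε (γ t) i, hγ t ht i]
  have hbound : ∀ ε ∈ Ioc 0 (r / 2), H (smoothSup p ε (γ b)) ≤
      H (smoothSup p ε (γ a)) + n * (M * L) * ε * (b - a) := by
    intro ε hε
    have hder : ∀ t ∈ Icc a b, HasDerivAt (fun s => H (smoothSup p ε (γ s))) _ t := fun t ht =>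
      ((hH.differentiableOn one_ne_zero).differentiableAt
        (hX.mem_nhds (hzX ε hε.1.le hε.2 t ht))).hasFDerivAt.comp_hasDerivAt t
          (hasDerivAt_smoothSup p hε.1.ne' (h.hasDerivAt t (hsub ht)))
    have := (convex_Icc a b).image_sub_le_mul_sub_of_deriv_le
      (fun t ht => (hder t ht).continuousAt.continuousWithinAt)
      (fun t ht => (hder t (interior_subset ht)).differentiableAt.differentiableWithinAt)
      (C := n * (M * L) * ε) (fun t ht => by
        rw [(hder t (interior_subset ht)).deriv]
        exact fderiv_smoothSup_le hX hf hcoop hH hfirst hfp hbox hε.1 hε.2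
          (hγ t (interior_subset ht)))
      a (left_mem_Icc.2 hab) b (right_mem_Icc.2 hab) hab
    linarith
  have hlim : ∀ t ∈ Icc a b, Tendsto (fun ε => H (smoothSup p ε (γ t))) (𝓝[>] 0)
      (𝓝 (H (smoothSup p 0 (γ t)))) := by
    intro t ht
    have hc : ContinuousAt (fun ε => smoothSup p ε (γ t)) 0 :=
      ((continuous_smoothSup p).comp (Continuous.prodMk_left (γ t))).continuousAt
    exact (hH.continuousOn.continuousAt
      (hX.mem_nhds (hzX 0 le_rfl (by positivity) t ht))).tendsto.comp
        (hc.tendsto.mono_left nhdsWithin_le_nhds)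
  have hlim2 : Tendsto (fun ε : ℝ => n * (M * L) * ε * (b - a)) (𝓝[>] 0) (𝓝 0) := by
    have hc : Continuous fun ε : ℝ => n * (M * L) * ε * (b - a) := by fun_prop
    simpa using (hc.tendsto 0).mono_left nhdsWithin_le_nhds
  have := le_of_tendsto_of_tendsto (hlim b (right_mem_Icc.2 hab))
    ((hlim a (left_mem_Icc.2 hab)).add hlim2)
    (by filter_upwards [Ioc_mem_nhdsGT (half_pos hr)] with ε hε using hbound ε hε)
  simpa using this

/-! ### Stability of equilibria and uniqueness of ω-limit points -/

/-- Equilibria are Lyapunov stable within their level set of the first integral. -/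
theorem IsSolution.stable_of_velocity_eq_zero (hX : IsOpen X) (hf : ContDiffOn ℝ 1 f X)
    (hcoop : IsCooperative f X) (hH : ContDiffOn ℝ 1 H X) (hfirst : IsFirstIntegral f X H)
    (hgrad : HasPositiveGradient X H) (hp : p ∈ X) (hfp : f p = 0)
    (h : IsSolution f X x J γ) (hHp : H x = H p) {η : ℝ} (hη : 0 < η) :
    ∀ᶠ w in 𝓝 p, ∀ a ∈ J, γ a = w → ∀ b ∈ J, a ≤ b → ∀ i, |γ b i - p i| < η := by
  obtain ⟨r, hr, c, hc, M, L, hbox⟩ := exists_box_bounds hX hf hH hgrad hp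
  have hbox' : ∀ w : EuclideanSpace ℝ (Fin n), (∀ i, |w i - p i| ≤ r) →
      w ∈ X ∧ ∀ i, 0 < gradient H w i ∧ gradient H w i < M ∧ |jacobian f w i i| < L :=
    fun w hw => ⟨(hbox w hw).1, fun i => ⟨hc.trans ((hbox w hw).2 i).1, ((hbox w hw).2 i).2⟩⟩
  obtain ⟨ρ, hρ, hρη, hρr⟩ : ∃ ρ > 0, ρ ≤ η ∧ ρ < r / 2 :=
    ⟨min η (r / 4), lt_min hη (by positivity), min_le_left _ _,
      (min_le_right _ _).trans_lt (by linarith)⟩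
  -- With z = w ∨ p, the difference H(z) - H(p) equals H(z) - H(w) on the level set, so it dominates
  -- both c(zᵢ - pᵢ) and c(zᵢ - wᵢ), one of which is c|wᵢ - pᵢ|.
  have hlow : ∀ w : EuclideanSpace ℝ (Fin n), H w = H p → (∀ i, |w i - p i| ≤ r / 2) →
      ∀ i, c * |w i - p i| ≤ H (smoothSup p 0 w) - H p := by
    intro w hw hwr i
    have hzr : ∀ j, smoothSup p 0 w j - p j ≤ r := fun j => by
      linarith [smoothSup_sub_le p le_rfl w j, hwr j]
    have hb : ∀ v : EuclideanSpace ℝ (Fin n),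
        (∀ j, -r ≤ v j - p j ∧ v j ≤ smoothSup p 0 w j) →
        v ∈ X ∧ ∀ j, c ≤ gradient H v j := fun v hv => by
      have := hbox v fun j => abs_le.2 ⟨(hv j).1, by linarith [(hv j).2, hzr j]⟩
      exact ⟨this.1, fun j => (this.2 j).1.le⟩
    have h1 := mul_sub_le_firstIntegral_sub hX hH hc.le (le_smoothSup_left p 0 w)
      (fun v hv => hb v fun j => ⟨by linarith [(hv j).1], (hv j).2⟩) i
    have h2 := mul_sub_le_firstIntegral_sub hX hH hc.le (le_smoothSup_right p 0 w)
      (fun v hv => hb v fun j =>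
        ⟨by linarith [(hv j).1, (abs_le.1 (hwr j)).1], (hv j).2⟩) i
    rw [hw] at h2
    refine (mul_le_mul_of_nonneg_left (abs_sub_le_max_smoothSup_sub p w i) hc.le).trans ?_
    rcases max_choice (smoothSup p 0 w i - p i) (smoothSup p 0 w i - w i) with e | e <;> rw [e]
    · exact h1
    · exact h2
  have hHc : ContinuousAt (fun w => H (smoothSup p 0 w)) p := by
    refine ContinuousAt.comp ?_
      ((continuous_smoothSup p).comp (Continuous.prodMk_right (0 : ℝ))).continuousAt
    rw [smoothSup_self]
    exact hH.continuousOn.continuousAt (hX.mem_nhds hp)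
  have hev1 : ∀ᶠ w in 𝓝 p, H (smoothSup p 0 w) < H p + c * ρ :=
    hHc.eventually_lt_const (by
      simp only [smoothSup_self]
      linarith [mul_pos hc hρ])
  filter_upwards [hev1, Metric.ball_mem_nhds p (half_pos hr)] with w hw1 hw2 a ha hγa b hb hab
  have hsub : Icc a b ⊆ J := h.ordConnected.out ha hb
  have hgood : ∀ t ∈ Icc a b, (∀ u ∈ Icc a t, ∀ i, |γ u i - p i| ≤ r / 2) →
      ∀ i, |γ t i - p i| < ρ := by
    intro t ht hu i
    have h1 := h.firstIntegral_smoothSup_le hX hf hcoop hH hfirst hfp hr hbox' ha (hsub ht) ht.1 hu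
    have h2 := hlow (γ t) ((hfirst.eq_of_isSolution hX hf h (hsub ht)).trans hHp)
      (hu t (right_mem_Icc.2 ht.1)) i
    rw [hγa] at h1
    exact lt_of_mul_lt_mul_left (by linarith) hc.le
  have hcont : ∀ i, ContinuousOn (fun t => |γ t i - p i|) (Icc a b) := fun i =>
    (((EuclideanSpace.proj i : EuclideanSpace ℝ (Fin n) →L[ℝ] ℝ).continuous.comp_continuousOn
      (h.continuousOn.mono hsub)).sub continuousOn_const).abs
  -- At a first time `τ` of reaching distance r/2, the Lyapunov bound ρ holds before `τ` and, by
  -- continuity, at `τ`; this contradicts ρ < r/2.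
  have hexit : ¬ ∃ t ∈ Icc a b, ∃ i, r / 2 ≤ |γ t i - p i| := by
    rintro ⟨t₀, ht₀, i₀, hi₀⟩
    have hclosed : IsCompact (⋃ i, Icc a b ∩ (fun t => |γ t i - p i|) ⁻¹' Ici (r / 2)) :=
      isCompact_iUnion fun i => isCompact_Icc.of_isClosed_subset
        ((hcont i).preimage_isClosed_of_isClosed isClosed_Icc isClosed_Ici) inter_subset_left
    obtain ⟨τ, hτ, hmin⟩ := hclosed.exists_isLeast ⟨t₀, mem_iUnion.2 ⟨i₀, ht₀, hi₀⟩⟩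
    obtain ⟨i, hτab, hτi⟩ := mem_iUnion.1 hτ
    have hbefore : ∀ u ∈ Icc a b, u < τ → ∀ j, |γ u j - p j| < r / 2 := by
      intro u hu huτ j
      by_contra! hle
      exact huτ.not_ge (hmin (mem_iUnion.2 ⟨j, hu, hle⟩))
    have haτ : a < τ := by
      refine hτab.1.lt_of_ne fun e => ?_
      have h1 := abs_apply_sub_le_dist w p i
      have h2 : r / 2 ≤ |γ τ i - p i| := hτi
      rw [← e, hγa] at h2
      exact absurd (Metric.mem_ball.1 hw2) (by linarith)
    have hle : ∀ u ∈ Ico a τ, |γ u i - p i| ≤ ρ := fun u hu =>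
      (hgood u ⟨hu.1, hu.2.le.trans hτab.2⟩ (fun v hv j => (hbefore v
        ⟨hv.1, hv.2.trans (hu.2.le.trans hτab.2)⟩ (hv.2.trans_lt hu.2) j).le) i).le
    have hτle : |γ τ i - p i| ≤ ρ := by
      have hcw : Tendsto (fun t => |γ t i - p i|) (𝓝[Ico a τ] τ) (𝓝 |γ τ i - p i|) :=
        ((hcont i) τ hτab).mono fun u hu => ⟨hu.1, hu.2.le.trans hτab.2⟩
      have : (𝓝[Ico a τ] τ).NeBot := by
        rw [← mem_closure_iff_nhdsWithin_neBot, closure_Ico haτ.ne]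
        exact right_mem_Icc.2 haτ.le
      exact le_of_tendsto hcw (by filter_upwards [self_mem_nhdsWithin] with u hu using hle u hu)
    exact (hτle.trans_lt hρr).not_ge hτi
  push Not at hexit
  intro i
  exact (hgood b (right_mem_Icc.2 hab) (fun u hu j => (hexit u hu j).le) i).trans_le hρη

/-- The solution comes arbitrarily close to the equilibrium `p`, which lies in its level set, and
stability keeps it within η of `p` in every coordinate from then on, so `y` is that close too. -/
theorem eq_of_mem_omegaLimitSet (hX : IsOpen X) (hf : ContDiffOn ℝ 1 f X)
    (hcoop : IsCooperativeIrreducible f X) (hH : ContDiffOn ℝ 1 H X)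
    (hfirst : IsFirstIntegral f X H) (hgrad : HasPositiveGradient X H)
    (hp : p ∈ omegaLimitSet f X x) (hy : y ∈ omegaLimitSet f X x) : y = p := by
  obtain ⟨hpX, J, γ, h, u, hu, hutop, hulim⟩ := hp
  obtain ⟨hyX, J', γ', h', v, hv, hvtop, hvlim⟩ := hy
  obtain ⟨rfl, heq⟩ := h.unique hX hf h'
  have hfp := h.1.velocity_eq_zero_of_tendsto_atTop hX hf hcoop hH hfirst hgrad hpX hu hutop hulim
  have hHp : H x = H p := by
    refine tendsto_nhds_unique ?_
      ((hH.continuousOn.continuousAt (hX.mem_nhds hpX)).tendsto.comp hulim)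
    exact tendsto_const_nhds.congr fun k => (hfirst.eq_of_isSolution hX hf h.1 (hu k)).symm
  ext i
  refine eq_of_abs_sub_nonpos (le_of_forall_gt_imp_ge_of_dense fun η hη => ?_)
  obtain ⟨k, hk⟩ := (hulim.eventually (h.1.stable_of_velocity_eq_zero hX hf hcoop.1 hH hfirst
    hgrad hpX hfp hHp hη)).exists
  have hlim : Tendsto (fun m => |γ' (v m) i - p i|) atTop (𝓝 |y i - p i|) :=
    ((((EuclideanSpace.proj i : EuclideanSpace ℝ (Fin n) →L[ℝ] ℝ).continuous.tendsto y).comp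
      hvlim).sub_const _).abs
  refine le_of_tendsto hlim ?_
  filter_upwards [hvtop.eventually_ge_atTop (u k)] with m hm
  rw [← heq (hv m)]
  exact (hk _ (hu k) rfl _ (hv m) hm i).le

end CooperativeODE

theorem theorem8 {n : ℕ} (X : Set (EuclideanSpace ℝ (Fin n))) (hX : IsOpen X)
    (f : EuclideanSpace ℝ (Fin n) → EuclideanSpace ℝ (Fin n)) (hf : ContDiffOn ℝ 1 f X)
    (hcoop : CooperativeODE.IsCooperativeIrreducible f X)
    (H : EuclideanSpace ℝ (Fin n) → ℝ) (hH : ContDiffOn ℝ 1 H X)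
    (hfirst : CooperativeODE.IsFirstIntegral f X H)
    (hgrad : CooperativeODE.HasPositiveGradient X H) :
    (∀ x ∈ X, CooperativeODE.omegaLimitSet f X x = ∅ ∨
      ∃ y, CooperativeODE.omegaLimitSet f X x = {y}) ∧
    (∀ x ∈ X, (CooperativeODE.alphaLimitSet f X x).Nonempty →
      CooperativeODE.IsEquilibrium f X x) := by
  refine ⟨fun x _ => ?_, fun x hx ⟨y, hy⟩ =>
    CooperativeODE.isEquilibrium_of_mem_alphaLimitSet hX hf hcoop hH hfirst hgrad hx hy⟩
  refine Set.Subsingleton.eq_empty_or_singleton fun y hy p hp => ?_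
  exact CooperativeODE.eq_of_mem_omegaLimitSet hX hf hcoop hH hfirst hgrad hp hy
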